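/- Let $d,n\ge 1$ and let $\mathcal S\subset\{0,1\}^d$ be a nonempty set such that for every $i\in\{1,\dots,d\}$ some $v\in\mathcal S$ has $v_i=1$. In the semi-bandit game on $\mathcal S$, in each round $t=1,\dots,n$ the forecaster draws $V_t\in\mathcal S$ from a distribution $p_t$ on $\mathcal S$ fixed before the round, while the adversary simultaneously selects a loss vector $\ell_t\in[0,\infty)^d$, possibly at random and depending on the previous rounds: conditionally on the past and on $\ell_t$, the action $V_t$ has law $p_t$. The forecaster then observes the coordinates $\ell_{i,t}$ for which $V_{i,t}=1$. The regret is $$\overline R_n=\mathbb E\sum_{t=1}^n \ell_t^TV_t-\min_{v\in\mathcal S}\mathbb E\sum_{t=1}^n\ell_t^Tv .$$ Assume the $L_2$ condition: $\ell_t^Tv\le 1$ for all $t$ and all $v\in\mathcal S$. For $q>1$ and $\eta>0$ let $F(u)=-\frac{q}{(q-1)\eta}\sum_{i=1}^d u_i^{(q-1)/q}$ on $[0,\infty)^d$, and $D_F(u,v)=F(u)-F(v)-(u-v)^T\nabla F(v)$ for $u\in[0,\infty)^d$, $v\in(0,\infty)^d$. The forecaster {\sc linpoly}, with importance-weighted estimates,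 starts from $w_1=\operatorname{argmin}_{w\in\mathrm{Conv}(\mathcal S)}D_F\big(w,(1,\dots,1)^T\big)\in(0,\infty)^d$. In each round $t=1,\dots,n$ it draws $V_t$ from a distribution $p_t$ on $\mathcal S$ with mean $w_t$, sets $\tilde\ell_{i,t}=\ell_{i,t}\frac{V_{i,t}}{w_{i,t}}$, takes $w'_{t+1}\in(0,\infty)^d$ with $\nabla F(w'_{t+1})=\nabla F(w_t)-\tilde\ell_t$, and takes $w_{t+1}\in\operatorname{argmin}_{w\in\mathrm{Conv}(\mathcal S)\cap(0,\infty)^d}D_F(w,w'_{t+1})$. Then for every $q>1$, {\sc linpoly} with $$\eta=\sqrt{\frac{2d^{1/q}}{q(q-1)n}}$$ satisfies $$\overline R_n\le\sqrt{\frac{2qnd}{q-1}\,d^{1-\frac1q}} .$$ In particular, if $d\ge 2$ and $q=1+(\log d)^{-1}$, then $$\overline R_n\le\sqrt{2e\,n\,d\,\log(ed)} .$$ -/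

import Mathlib

open MeasureTheory

/-- The set `[0, ∞)^d`, the domain `𝒟` of the potential of linpoly. -/
def nonnegOrthant (d : ℕ) : Set (EuclideanSpace ℝ (Fin d)) :=
  {u | ∀ i, 0 ≤ u i}

/-- The vector `(1, …, 1)`. -/
noncomputable def onesVec (d : ℕ) : EuclideanSpace ℝ (Fin d) :=
  WithLp.toLp 2 (fun _ => (1 : ℝ))

/-- The Bregman divergence `D_F(u, v) = F(u) - F(v) - (u - v)ᵀ ∇F(v)`, meaningful for `v` in the
interior of the domain of `F`. -/
noncomputable def bregmanDiv {d : ℕ} (F : EuclideanSpace ℝ (Fin d) → ℝ)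
    (u v : EuclideanSpace ℝ (Fin d)) : ℝ :=
  F u - F v - inner ℝ (u - v) (gradient F v)

/-- One run of the CLEB forecaster (combinatorial learning with Bregman projections) with potential
`F` on the domain `D` and action set `S`, over `n` rounds numbered `0, …, n - 1`. Here `w t` is the
weight vector, `p t` the distribution on `S` used for drawing the action, and `lossEst t` the
estimate of the loss vector in round `t`. -/
structure IsCLEBRun {d : ℕ} (D : Set (EuclideanSpace ℝ (Fin d)))
    (F : EuclideanSpace ℝ (Fin d) → ℝ) (S : Finset (EuclideanSpace ℝ (Fin d))) (n : ℕ)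
    (w : ℕ → EuclideanSpace ℝ (Fin d)) (p : ℕ → EuclideanSpace ℝ (Fin d) → ℝ)
    (lossEst : ℕ → EuclideanSpace ℝ (Fin d)) : Prop where
  /-- The initial weight vector is an admissible parameter. -/
  init_mem : w 0 ∈ convexHull ℝ (S : Set (EuclideanSpace ℝ (Fin d))) ∩ interior D
  /-- `p t` is a probability distribution on `S` … -/
  p_nonneg : ∀ t < n, ∀ v ∈ S, 0 ≤ p t v
  p_sum : ∀ t < n, ∑ v ∈ S, p t v = 1
  /-- … with mean `w t`. -/
  p_mean : ∀ t < n, ∑ v ∈ S, p t v • v = w t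
  /-- Gradient step followed by a Bregman projection onto the convex hull of `S`. -/
  update : ∀ t < n, ∃ w' ∈ interior D,
    gradient F w' = gradient F (w t) - lossEst t ∧
    w (t + 1) ∈ convexHull ℝ (S : Set (EuclideanSpace ℝ (Fin d))) ∩ interior D ∧
    IsMinOn (fun u => bregmanDiv F u w')
      (convexHull ℝ (S : Set (EuclideanSpace ℝ (Fin d))) ∩ interior D) (w (t + 1))

/-- The potential `F(u) = -(q / ((q - 1) η)) ∑ i, u_i ^ ((q - 1) / q)` of linpoly. -/
noncomputable def linpolyPotential {d : ℕ} (q η : ℝ) (u : EuclideanSpace ℝ (Fin d)) : ℝ :=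
  -(q / ((q - 1) * η)) * ∑ i, (u i) ^ ((q - 1) / q)

/-- The importance-weighted loss estimate `ℓ_i V_i / w_i`. As `V_i ∈ {0, 1}`, it depends on `ℓ` only
through the coordinates with `V_i = 1`, which are the ones observed in the semi-bandit game. -/
noncomputable def importanceWeightedEst {d : ℕ} (l v w : EuclideanSpace ℝ (Fin d)) :
    EuclideanSpace ℝ (Fin d) :=
  WithLp.toLp 2 (fun i => l i * (v i / w i))

/-- A run of linpoly with parameters `q`, `η`, in the semi-bandit game: CLEB on `[0, ∞)^d` with the
linpoly potential and the importance-weighted estimates of the losses `l`, where `V t` is the action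
played in round `t`, started at the Bregman projection of `(1, …, 1)` onto the convex hull of
`S`. -/
structure IsLinpolyRun {d : ℕ} (q η : ℝ) (S : Finset (EuclideanSpace ℝ (Fin d))) (n : ℕ)
    (w : ℕ → EuclideanSpace ℝ (Fin d)) (p : ℕ → EuclideanSpace ℝ (Fin d) → ℝ)
    (V l : ℕ → EuclideanSpace ℝ (Fin d)) : Prop where
  cleb : IsCLEBRun (nonnegOrthant d) (linpolyPotential q η) S n w p
    (fun t => importanceWeightedEst (l t) (V t) (w t))
  init_min : IsMinOn (fun u => bregmanDiv (linpolyPotential q η) u (onesVec d))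
    (convexHull ℝ (S : Set (EuclideanSpace ℝ (Fin d)))) (w 0)

/-- The protocol of a combinatorial prediction game with `n` rounds (numbered `0, …, n - 1`) and
action set `S`, played by a randomized forecaster against a possibly randomized adversary, who may
react to everything that happened in the earlier rounds. `ℱ t` is all the information present before
round `t` (past actions, past losses, past internal randomization of both players). In
round `t` the forecaster draws `V t` from the distribution `p t` on `S` while the adversary
simultaneously selects `l t`. The forecaster's `p t` may in particular be a function of his own
past observations only, as in the semi-bandit game. -/
structure IsPredictionGame {d : ℕ} {Ω : Type*} {mΩ : MeasurableSpace Ω} (P : Measure Ω)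
    (ℱ : Filtration ℕ mΩ) (S : Finset (EuclideanSpace ℝ (Fin d))) (n : ℕ)
    (p : ℕ → Ω → EuclideanSpace ℝ (Fin d) → ℝ)
    (V l : ℕ → Ω → EuclideanSpace ℝ (Fin d)) : Prop where
  /-- `p t` is fixed before round `t`. -/
  p_meas : ∀ t < n, ∀ v ∈ S, Measurable[ℱ t] (fun ω => p t ω v)
  V_mem : ∀ t < n, ∀ ω, V t ω ∈ S
  V_meas : ∀ t < n, Measurable[ℱ (t + 1)] (V t)
  l_nonneg : ∀ t < n, ∀ ω i, 0 ≤ l t ω i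
  l_meas : ∀ t < n, Measurable[ℱ (t + 1)] (l t)
  /-- Conditionally on the past and on the simultaneously selected loss vector, `V t` has
  distribution `p t`. -/
  draw : ∀ t < n, ∀ v ∈ S,
    P[({ω | V t ω = v}).indicator (fun _ => (1 : ℝ)) |
        ℱ t ⊔ MeasurableSpace.comap (l t) inferInstance] =ᵐ[P] fun ω => p t ω v

/-- The regret `E ∑ t, ℓ_tᵀ V_t - min_{v ∈ S} E ∑ t, ℓ_tᵀ v`. -/
noncomputable def expectedRegret {d : ℕ} {Ω : Type*} {mΩ : MeasurableSpace Ω} (P : Measure Ω)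
    (S : Finset (EuclideanSpace ℝ (Fin d))) (hS : S.Nonempty) (n : ℕ)
    (V l : ℕ → Ω → EuclideanSpace ℝ (Fin d)) : ℝ :=
  (∫ ω, ∑ t ∈ Finset.range n, inner ℝ (l t ω) (V t ω) ∂P) -
    S.inf' hS (fun v => ∫ ω, ∑ t ∈ Finset.range n, inner ℝ (l t ω) v ∂P)

/-! The argument is mirror descent, made pathwise first and averaged afterwards. For an action `v`,
the three-point identity expresses the estimated regret of a round as the drop of `D_F(v, ·)` from
`w t` to the unprojected point `w'`, plus the stability term `D_F(w t, w')`. Projecting does not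
increase the divergence from `v` (`bregmanDiv_le_of_isMinOn`), so the sum telescopes. What is left
is `D_F(v, 1)`, at most `d / ((q - 1) η)` because `v` is a 0/1 vector, and the stability terms. The
potential is separable, and `powerDiv_le` bounds each stability term by `(η q / 2) ∑ i, w_i ^ (1 +
1/q) z_i ^ 2`, where `z` is the estimated loss.

Given the past and the loss, `V` has mean `w`. Hence the estimate is unbiased, and since `V_i ^ 2 =
V_i` the stability sum averages to that of `∑ i, l_i ^ 2 w_i ^ (1/q)`. The `L_2` condition gives `∑
i, l_i w_i ≤ 1` and, as every coordinate is used by some action, `l_i ≤ 1`; so this sum is at most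
`d ^ (1 - 1/q)` (`sum_sq_mul_rpow_le`). The prescribed `η` balances the two terms.

The one measure-theoretic difficulty is that `l_i / w_i` need not be bounded. Conditional
expectations are therefore applied to nonnegative functions through lower integrals, and
integrability of the estimates is derived, not assumed. -/

/-! ### Scalar inequalities -/

/-- The Bregman divergence of `x ↦ -(q / (q - 1)) x ^ ((q - 1) / q)` on the half-line. -/
noncomputable def powerDiv (q x y : ℝ) : ℝ :=
  q / (q - 1) * (y ^ ((q - 1) / q) - x ^ ((q - 1) / q)) + (x - y) * y ^ (-(1 / q))

/-- Concavity of `x ^ ((q - 1) / q)`, in the form of Bernoulli's inequality at `x / y`. -/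
theorem powerDiv_nonneg {q x y : ℝ} (hq : 1 < q) (hx : 0 ≤ x) (hy : 0 < y) :
    0 ≤ powerDiv q x y := by
  have hq1 : 0 < q - 1 := by linarith
  have hq0 : 0 < q := by linarith
  have hb := rpow_one_add_le_one_add_mul_self (s := x / y - 1)
    (by have := div_nonneg hx hy.le; linarith) (p := (q - 1) / q) (by positivity)
    (by rw [div_le_one hq0]; linarith)
  rw [add_sub_cancel, Real.div_rpow hx hy.le] at hb
  have hyθ : 0 < y ^ ((q - 1) / q) := by positivity
  rw [div_le_iff₀ hyθ] at hb
  have hyr : y ^ (-(1 / q)) = y ^ ((q - 1) / q) / y := by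
    rw [← Real.rpow_sub_one hy.ne']
    congr 1
    field_simp
    ring
  have key : powerDiv q x y = q / (q - 1) *
      ((1 + (q - 1) / q * (x / y - 1)) * y ^ ((q - 1) / q) - x ^ ((q - 1) / q)) := by
    unfold powerDiv
    rw [hyr]
    field_simp
    ring
  rw [key]
  have : 0 ≤ q / (q - 1) := by positivity
  exact mul_nonneg this (by linarith)

theorem powerDiv_one_le {q x : ℝ} (hq : 1 < q) (hx : x = 0 ∨ x = 1) :
    powerDiv q x 1 ≤ (q - 1)⁻¹ := by
  have hq1 : 0 < q - 1 := by linarith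
  have hq0 : 0 < q := by linarith
  rcases hx with rfl | rfl
  · rw [powerDiv, Real.zero_rpow (by positivity), Real.one_rpow, Real.one_rpow]
    apply le_of_eq
    field_simp
    ring
  · simp only [powerDiv, sub_self, zero_mul, mul_zero, add_zero]
    positivity

/-- The right side is the second-order Taylor polynomial at 0. The difference of the two sides
vanishes at 0, and its derivative is nonnegative as soon as `(1 + x) ^ (-q) ≥ 1 - q x`. -/
theorem one_add_rpow_one_sub_le {q s : ℝ} (hq : 1 < q) (hs : 0 ≤ s) :
    (1 + s) ^ (1 - q) ≤ 1 - (q - 1) * s + q * (q - 1) / 2 * s ^ 2 := by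
  have hd : ∀ x : ℝ, 0 ≤ x → HasDerivAt
      (fun x : ℝ => 1 - (q - 1) * x + q * (q - 1) / 2 * x ^ 2 - (1 + x) ^ (1 - q))
      ((q - 1) * ((1 + x) ^ (-q) - (1 - q * x))) x := by
    intro x hx
    have h1 : HasDerivAt (fun x : ℝ => 1 + x) 1 x := (hasDerivAt_id x).const_add 1
    have h2 := h1.rpow_const (p := 1 - q) (Or.inl (by linarith))
    have h3 := ((((hasDerivAt_id x).const_mul (q - 1)).const_sub 1).add
      (((hasDerivAt_id x).pow 2).const_mul (q * (q - 1) / 2))).sub h2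
    refine h3.congr_deriv ?_
    rw [show 1 - q - 1 = -q by ring]
    simp
    ring
  have hmono : MonotoneOn
      (fun x : ℝ => 1 - (q - 1) * x + q * (q - 1) / 2 * x ^ 2 - (1 + x) ^ (1 - q))
      (Set.Ici 0) := by
    apply monotoneOn_of_deriv_nonneg (convex_Ici 0)
    · exact fun x hx => (hd x hx).continuousAt.continuousWithinAt
    · intro x hx
      rw [interior_Ici] at hx
      exact (hd x (le_of_lt hx)).differentiableAt.differentiableWithinAt
    · intro x hx
      rw [interior_Ici] at hx
      have hx0 : 0 < x := hx
      rw [(hd x hx0.le).deriv]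
      refine mul_nonneg (by linarith) ?_
      have h1x : 0 < 1 + x := by linarith
      have hxx : x / (1 + x) ≤ x := div_le_self hx0.le (by linarith)
      have hx1 : x / (1 + x) ≤ 1 := (div_le_one h1x).2 (by linarith)
      -- Bernoulli for the exponent `q`, applied to `1 / (1 + x) = 1 - x / (1 + x)`.
      have hb := one_add_mul_self_le_rpow_one_add (s := -(x / (1 + x))) (by linarith) hq.le
      rw [show 1 + -(x / (1 + x)) = (1 + x)⁻¹ by field_simp; ring, Real.inv_rpow h1x.le,
        ← Real.rpow_neg h1x.le] at hb
      nlinarith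
  have := hmono (Set.mem_Ici.2 le_rfl) (Set.mem_Ici.2 hs) hs
  simp at this
  linarith

/-- If the derivative of the potential moves by `z`, the divergence is at most quadratic in `z`. -/
theorem powerDiv_le {q x y z : ℝ} (hq : 1 < q) (hx : 0 < x) (hy : 0 < y) (hz : 0 ≤ z)
    (hxy : y ^ (-(1 / q)) = x ^ (-(1 / q)) + z) :
    powerDiv q x y ≤ q / 2 * x ^ (1 + 1 / q) * z ^ 2 := by
  have hq1 : 0 < q - 1 := by linarith
  have hq0 : 0 < q := by linarith
  -- In the dual coordinates `a`, `b` the hypothesis is a translation, `b = a + z`. The divergence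
  -- becomes `a ^ (1 - q) / (q - 1)` times the first-order Taylor remainder of `(1 + s) ^ (1 - q)`
  -- at `s = z / a`.
  set a := x ^ (-(1 / q)) with ha
  set b := y ^ (-(1 / q)) with hb
  have ha0 : 0 < a := by positivity
  have hb0 : 0 < b := by positivity
  have hxa : x = a ^ (-q) := by
    rw [ha, ← Real.rpow_mul hx.le]
    field_simp
    simp
  have hyb : y = b ^ (-q) := by
    rw [hb, ← Real.rpow_mul hy.le]
    field_simp
    simp
  have e1 : x ^ ((q - 1) / q) = a ^ (1 - q) := by
    rw [hxa, ← Real.rpow_mul ha0.le]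
    congr 1
    field_simp
    ring
  have e2 : y ^ ((q - 1) / q) = b ^ (1 - q) := by
    rw [hyb, ← Real.rpow_mul hb0.le]
    congr 1
    field_simp
    ring
  have e3 : x ^ (1 + 1 / q) = a ^ (1 - q) / a ^ 2 := by
    rw [hxa, ← Real.rpow_mul ha0.le, ← Real.rpow_natCast, ← Real.rpow_sub ha0]
    congr 1
    field_simp
    push_cast
    ring
  have e4 : x = a ^ (1 - q) / a := by
    rw [hxa, ← Real.rpow_sub_one ha0.ne']
    congr 1
    ring
  have e5 : y * b = b ^ (1 - q) := by
    rw [hyb, ← Real.rpow_add_one hb0.ne']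
    congr 1
    ring
  have e6 : b ^ (1 - q) = a ^ (1 - q) * (1 + z / a) ^ (1 - q) := by
    rw [← Real.mul_rpow ha0.le (by positivity)]
    congr 1
    rw [hxy]
    field_simp
  have main := one_add_rpow_one_sub_le hq (s := z / a) (by positivity)
  have hA : 0 < a ^ (1 - q) := by positivity
  have e7 : powerDiv q x y = a ^ (1 - q) / (q - 1) * ((1 + z / a) ^ (1 - q)
      - q + (q - 1) * (1 + z / a)) := by
    have : powerDiv q x y = q / (q - 1) * (b ^ (1 - q) - a ^ (1 - q)) + x * b - y * b := by
      rw [powerDiv, e1, e2]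
      ring
    rw [this, e5, e6, hxy]
    nth_rewrite 1 [e4]
    field_simp
    ring
  rw [e7, e3]
  calc _ ≤ a ^ (1 - q) / (q - 1) * (q * (q - 1) / 2 * (z / a) ^ 2) := by
        gcongr
        linarith
    _ = _ := by field_simp

/-- As `0 ≤ l ≤ 1` and `1 / q ≤ 2`, `l ^ 2 ≤ l ^ (1/q)`. The power-mean inequality then compares `∑
(l w) ^ (1/q)` with `(∑ l w) ^ (1/q)`. -/
theorem sum_sq_mul_rpow_le {ι : Type*} (s : Finset ι) {q : ℝ} (hq : 1 < q) (l w : ι → ℝ)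
    (hl0 : ∀ i ∈ s, 0 ≤ l i) (hl1 : ∀ i ∈ s, l i ≤ 1) (hw : ∀ i ∈ s, 0 ≤ w i)
    (hlw : ∑ i ∈ s, l i * w i ≤ 1) :
    ∑ i ∈ s, l i ^ 2 * w i ^ (1 / q) ≤ (s.card : ℝ) ^ (1 - 1 / q) := by
  have hq0 : 0 < q := by linarith
  have h1 : ∑ i ∈ s, l i ^ 2 * w i ^ (1 / q) ≤ ∑ i ∈ s, (l i * w i) ^ (1 / q) := by
    apply Finset.sum_le_sum
    intro i hi
    rw [Real.mul_rpow (hl0 i hi) (hw i hi)]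
    refine mul_le_mul_of_nonneg_right ?_ (Real.rpow_nonneg (hw i hi) _)
    rw [← Real.rpow_natCast]
    refine Real.rpow_le_rpow_of_exponent_ge_of_imp (hl0 i hi) (hl1 i hi) ?_ ?_
    · rw [div_le_iff₀ hq0]; push_cast; linarith
    · intro _ h
      simp at h
  refine h1.trans ?_
  have hnn : ∀ i ∈ s, 0 ≤ (l i * w i) ^ (1 / q) := fun i hi =>
    Real.rpow_nonneg (mul_nonneg (hl0 i hi) (hw i hi)) _
  have h2 := Real.rpow_sum_le_const_mul_sum_rpow_of_nonneg (s := s) hq.le hnn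
  have h3 : ∑ i ∈ s, ((l i * w i) ^ (1 / q)) ^ q = ∑ i ∈ s, l i * w i := by
    refine Finset.sum_congr rfl fun i hi => ?_
    rw [← Real.rpow_mul (mul_nonneg (hl0 i hi) (hw i hi)), one_div_mul_cancel hq0.ne',
      Real.rpow_one]
  rw [h3] at h2
  have h4 : (∑ i ∈ s, (l i * w i) ^ (1 / q)) ^ q ≤ (s.card : ℝ) ^ (q - 1) :=
    h2.trans (mul_le_of_le_one_right (by positivity) hlw)
  have h5 := Real.rpow_le_rpow (by have := Finset.sum_nonneg hnn; positivity) h4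
    (z := 1 / q) (by positivity)
  rw [← Real.rpow_mul (Finset.sum_nonneg hnn), mul_one_div_cancel hq0.ne', Real.rpow_one,
    ← Real.rpow_mul (by positivity)] at h5
  refine h5.trans (le_of_eq ?_)
  congr 1
  field_simp

/-! ### Gradient and divergence of the potential -/

theorem interior_nonnegOrthant (d : ℕ) :
    interior (nonnegOrthant d) = {u : EuclideanSpace ℝ (Fin d) | ∀ i, 0 < u i} := by
  apply Set.Subset.antisymm
  · intro u hu i
    -- An interior point can be moved slightly in the direction `-e_i` without leaving the orthant.
    have hc : Continuous fun s : ℝ => u - s • EuclideanSpace.single i (1 : ℝ) := by fun_prop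
    have h0 : ∀ᶠ s in nhds (0 : ℝ), u - s • EuclideanSpace.single i (1 : ℝ) ∈ nonnegOrthant d :=
      hc.continuousAt.eventually_mem (by simpa using mem_interior_iff_mem_nhds.1 hu)
    obtain ⟨ε, hε, hb⟩ := Metric.eventually_nhds_iff.1 h0
    have := hb (y := ε / 2) (by rw [Real.dist_0_eq_abs, abs_of_pos (by positivity)]; linarith) i
    simp at this
    linarith
  · refine interior_maximal (fun u hu i => (hu i).le) ?_
    simp only [Set.ofPred_forall]
    exact isOpen_iInter_of_finite fun i => isOpen_lt continuous_const (by fun_prop)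

theorem hasGradientAt_linpolyPotential {d : ℕ} {q : ℝ} (η : ℝ) (hq : 1 < q)
    {w : EuclideanSpace ℝ (Fin d)} (hw : ∀ i, 0 < w i) :
    HasGradientAt (linpolyPotential q η)
      (WithLp.toLp 2 fun i => -(η⁻¹ * (w i) ^ (-(1 / q)))) w := by
  have hq1 : q - 1 ≠ 0 := by linarith
  have hq0 : q ≠ 0 := by linarith
  rw [hasGradientAt_iff_hasFDerivAt]
  have h1 : ∀ i ∈ Finset.univ, HasFDerivAt
      (fun u : EuclideanSpace ℝ (Fin d) => (u i) ^ ((q - 1) / q))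
      (((q - 1) / q * (w i) ^ ((q - 1) / q - 1)) •
        (EuclideanSpace.proj i : EuclideanSpace ℝ (Fin d) →L[ℝ] ℝ)) w := fun i _ =>
    (EuclideanSpace.proj i : EuclideanSpace ℝ (Fin d) →L[ℝ] ℝ).hasFDerivAt.rpow_const
      (Or.inl (hw i).ne')
  have h2 := (HasFDerivAt.fun_sum h1).const_mul (-(q / ((q - 1) * η)))
  refine h2.congr_fderiv ?_
  ext v
  simp only [smul_apply, sum_apply,
    smul_eq_mul, InnerProductSpace.toDual_apply_apply,
    PiLp.inner_apply, Finset.mul_sum]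
  refine Finset.sum_congr rfl fun i _ => ?_
  rw [show (q - 1) / q - 1 = -(1 / q) by field_simp; ring]
  simp only [RCLike.inner_apply, conj_trivial]
  rcases eq_or_ne η 0 with rfl | hη
  · simp
  field_simp
  rfl

theorem gradient_linpolyPotential {d : ℕ} {q : ℝ} (η : ℝ) (hq : 1 < q)
    {w : EuclideanSpace ℝ (Fin d)} (hw : ∀ i, 0 < w i) :
    gradient (linpolyPotential q η) w = WithLp.toLp 2 fun i => -(η⁻¹ * (w i) ^ (-(1 / q))) :=
  (hasGradientAt_linpolyPotential η hq hw).gradient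

theorem bregmanDiv_linpolyPotential {d : ℕ} {q η : ℝ} (hq : 1 < q)
    (u : EuclideanSpace ℝ (Fin d)) {w : EuclideanSpace ℝ (Fin d)} (hw : ∀ i, 0 < w i) :
    bregmanDiv (linpolyPotential q η) u w = ∑ i, η⁻¹ * powerDiv q (u i) (w i) := by
  rw [bregmanDiv, gradient_linpolyPotential η hq hw]
  simp only [linpolyPotential, powerDiv, PiLp.inner_apply, Finset.mul_sum,
    ← Finset.sum_sub_distrib]
  refine Finset.sum_congr rfl fun i _ => ?_
  simp only [RCLike.inner_apply, conj_trivial, PiLp.sub_apply]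
  rw [← div_div, div_eq_mul_inv _ η]
  ring

/-! ### Bregman projections and the pathwise regret bound -/

theorem bregmanDiv_three_point {d : ℕ} (F : EuclideanSpace ℝ (Fin d) → ℝ)
    (u v w : EuclideanSpace ℝ (Fin d)) :
    inner ℝ (gradient F v - gradient F w) (v - u) =
      bregmanDiv F u v - bregmanDiv F u w + bregmanDiv F v w := by
  simp only [bregmanDiv, inner_sub_left, inner_sub_right, real_inner_comm (gradient F _)]
  ring

/-- First-order optimality of Bregman projections, in the form of the generalized Pythagorean
inequality. -/
theorem bregmanDiv_le_of_isMinOn {d : ℕ} {F : EuclideanSpace ℝ (Fin d) → ℝ}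
    {C : Set (EuclideanSpace ℝ (Fin d))} (hC : Convex ℝ C) {u v w : EuclideanSpace ℝ (Fin d)}
    (hv : v ∈ C) {c : ℝ} (hc : 0 < c) (hu : v + c • (u - v) ∈ C) (hF : DifferentiableAt ℝ F v)
    (hmin : IsMinOn (fun x => bregmanDiv F x w) C v) (hpos : 0 ≤ bregmanDiv F v w) :
    bregmanDiv F u v ≤ bregmanDiv F u w := by
  have hder : HasFDerivAt (fun x => bregmanDiv F x w)
      (InnerProductSpace.toDual ℝ _ (gradient F v - gradient F w)) v := by
    have h1 := hF.hasGradientAt.hasFDerivAt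
    have h2 : HasFDerivAt (fun x => inner ℝ (x - w) (gradient F w))
        (InnerProductSpace.toDual ℝ _ (gradient F w)) v := by
      have : (fun x => inner ℝ (x - w) (gradient F w)) = fun x =>
          InnerProductSpace.toDual ℝ _ (gradient F w) x - inner ℝ (gradient F w) w := by
        ext x
        rw [InnerProductSpace.toDual_apply_apply, inner_sub_left, real_inner_comm,
          real_inner_comm w]
      rw [this]
      exact (InnerProductSpace.toDual ℝ _ (gradient F w)).hasFDerivAt.sub_const _
    rw [map_sub]
    exact (h1.sub_const _).sub h2
  -- The comparator `u` need not lie in `C`: a point of `C` on the ray from `v` towards `u` already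
  -- makes `u - v` an admissible direction up to the factor `c`. This matters because vertices of
  -- the hull may have zero coordinates and so lie outside the open orthant.
  have hopt := hmin.localize.hasFDerivWithinAt_nonneg hder.hasFDerivWithinAt
    (sub_mem_posTangentConeAt_of_segment_subset (hC.segment_subset hv hu))
  rw [add_sub_cancel_left, map_smul, InnerProductSpace.toDual_apply_apply, smul_eq_mul] at hopt
  have hopt' : 0 ≤ inner ℝ (gradient F v - gradient F w) (u - v) :=
    nonneg_of_mul_nonneg_right hopt hc
  have h3 := bregmanDiv_three_point F u v w
  rw [← neg_sub u v, inner_neg_right] at h3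
  linarith

theorem bregmanDiv_linpolyPotential_nonneg {d : ℕ} {q η : ℝ} (hq : 1 < q) (hη : 0 ≤ η)
    {u w : EuclideanSpace ℝ (Fin d)} (hu : ∀ i, 0 ≤ u i) (hw : ∀ i, 0 < w i) :
    0 ≤ bregmanDiv (linpolyPotential q η) u w := by
  rw [bregmanDiv_linpolyPotential hq u hw]
  exact Finset.sum_nonneg fun i _ =>
    mul_nonneg (inv_nonneg.2 hη) (powerDiv_nonneg hq (hu i) (hw i))

theorem bregmanDiv_linpolyPotential_onesVec_le {d : ℕ} {q η : ℝ} (hq : 1 < q) (hη : 0 ≤ η)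
    {v : EuclideanSpace ℝ (Fin d)} (hv : ∀ i, v i = 0 ∨ v i = 1) :
    bregmanDiv (linpolyPotential q η) v (onesVec d) ≤ d / ((q - 1) * η) := by
  rw [bregmanDiv_linpolyPotential hq v (w := onesVec d) (fun i => by simp [onesVec])]
  calc _ ≤ ∑ _i : Fin d, η⁻¹ * (q - 1)⁻¹ := Finset.sum_le_sum fun i _ =>
        mul_le_mul_of_nonneg_left (powerDiv_one_le hq (hv i)) (inv_nonneg.2 hη)
    _ = _ := by
        rw [Finset.sum_const, Finset.card_univ, Fintype.card_fin, nsmul_eq_mul, ← mul_inv,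
          mul_comm η, div_eq_mul_inv]

theorem bregmanDiv_linpolyPotential_le {d : ℕ} {q η : ℝ} (hq : 1 < q) (hη : 0 < η)
    {w w' z : EuclideanSpace ℝ (Fin d)} (hw : ∀ i, 0 < w i) (hw' : ∀ i, 0 < w' i)
    (hz : ∀ i, 0 ≤ z i)
    (h : gradient (linpolyPotential q η) w' = gradient (linpolyPotential q η) w - z) :
    bregmanDiv (linpolyPotential q η) w w' ≤
      η * q / 2 * ∑ i, (w i) ^ (1 + 1 / q) * z i ^ 2 := by
  rw [gradient_linpolyPotential η hq hw, gradient_linpolyPotential η hq hw'] at h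
  rw [bregmanDiv_linpolyPotential hq w hw', Finset.mul_sum]
  refine Finset.sum_le_sum fun i _ => ?_
  have hi := congrArg (fun x : EuclideanSpace ℝ (Fin d) => x i) h
  simp only [PiLp.sub_apply] at hi
  -- The gradient carries a factor `η⁻¹`, so the dual coordinate moves by `η * z i`.
  have hi' : (w' i) ^ (-(1 / q)) = (w i) ^ (-(1 / q)) + η * z i := by
    field_simp at hi ⊢
    linarith
  have := powerDiv_le hq (hw i) (hw' i) (mul_nonneg hη.le (hz i)) hi'
  calc _ ≤ η⁻¹ * (q / 2 * (w i) ^ (1 + 1 / q) * (η * z i) ^ 2) := by gcongr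
    _ = _ := by field_simp

/-- The pathwise regret bound of CLEB with the potential of linpoly, in terms of the estimated
losses. -/
theorem IsCLEBRun.sum_inner_sub_le {d : ℕ} {q η : ℝ} {S : Finset (EuclideanSpace ℝ (Fin d))}
    {n : ℕ} {w : ℕ → EuclideanSpace ℝ (Fin d)} {p : ℕ → EuclideanSpace ℝ (Fin d) → ℝ}
    {z : ℕ → EuclideanSpace ℝ (Fin d)} (hq : 1 < q) (hη : 0 < η)
    (hrun : IsCLEBRun (nonnegOrthant d) (linpolyPotential q η) S n w p z)
    (hinit : IsMinOn (fun u => bregmanDiv (linpolyPotential q η) u (onesVec d))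
      (convexHull ℝ (S : Set (EuclideanSpace ℝ (Fin d)))) (w 0))
    (hz : ∀ t < n, ∀ i, 0 ≤ z t i) {v : EuclideanSpace ℝ (Fin d)} (hvS : v ∈ S)
    (hv : ∀ i, v i = 0 ∨ v i = 1) :
    ∑ t ∈ Finset.range n, inner ℝ (z t) (w t - v) ≤
      d / ((q - 1) * η) +
        η * q / 2 * ∑ t ∈ Finset.range n, ∑ i, (w t i) ^ (1 + 1 / q) * z t i ^ 2 := by
  set F := linpolyPotential (d := d) q η with hF
  set C := convexHull ℝ (S : Set (EuclideanSpace ℝ (Fin d))) ∩ interior (nonnegOrthant d) with hC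
  have hv0 : ∀ i, 0 ≤ v i := fun i => by rcases hv i with h | h <;> simp [h]
  have hpos : ∀ x ∈ C, ∀ i, 0 < x i := fun x hx => by
    have := hx.2
    rwa [interior_nonnegOrthant] at this
  have hconv : Convex ℝ C := by
    refine (convex_convexHull ℝ _).inter (Convex.interior ?_)
    intro x hx y hy a b ha hb _ i
    exact add_nonneg (mul_nonneg ha (hx i)) (mul_nonneg hb (hy i))
  have hmem : ∀ t ≤ n, w t ∈ C := by
    intro t ht
    rcases t with _ | t
    · exact hrun.init_mem
    · obtain ⟨_, _, _, h, _⟩ := hrun.update t ht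
      exact h
  -- Halfway from a positive point to a nonnegative one all coordinates are positive, so the
  -- midpoint is the witness required for the projection inequality.
  have hmid : ∀ x ∈ C, x + (1 / 2 : ℝ) • (v - x) ∈ C := by
    intro x hx
    refine ⟨(convex_convexHull ℝ _).add_smul_sub_mem hx.1 (subset_convexHull ℝ _ hvS)
      ⟨by norm_num, by norm_num⟩, ?_⟩
    rw [interior_nonnegOrthant]
    intro i
    have h1 := hpos x hx i
    have h2 := hv0 i
    simp only [PiLp.add_apply, PiLp.smul_apply, PiLp.sub_apply, smul_eq_mul]
    linarith
  have hpyth : ∀ x ∈ C, ∀ y, (∀ i, 0 < y i) → IsMinOn (fun u => bregmanDiv F u y) C x →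
      bregmanDiv F v x ≤ bregmanDiv F v y := fun x hx y hy hmin =>
    bregmanDiv_le_of_isMinOn hconv hx (by norm_num) (hmid x hx)
      (hasGradientAt_linpolyPotential η hq (hpos x hx)).differentiableAt hmin
      (bregmanDiv_linpolyPotential_nonneg hq hη.le (fun i => (hpos x hx i).le) hy)
  have hstep : ∀ t ∈ Finset.range n, inner ℝ (z t) (w t - v) ≤
      (bregmanDiv F v (w t) - bregmanDiv F v (w (t + 1))) +
        η * q / 2 * ∑ i, (w t i) ^ (1 + 1 / q) * z t i ^ 2 := by
    intro t ht
    rw [Finset.mem_range] at ht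
    obtain ⟨w', hw', hgrad, hnext, hmin⟩ := hrun.update t ht
    rw [interior_nonnegOrthant] at hw'
    have h1 := hpyth _ hnext w' hw' hmin
    have h2 := bregmanDiv_linpolyPotential_le hq hη (hpos _ (hmem t ht.le)) hw' (hz t ht) hgrad
    have h3 := bregmanDiv_three_point F v (w t) w'
    rw [hgrad, sub_sub_cancel] at h3
    linarith
  have hsum := Finset.sum_le_sum hstep
  rw [Finset.sum_add_distrib, Finset.sum_range_sub', ← Finset.mul_sum] at hsum
  -- The initial weight minimizes over the whole hull and is itself positive, hence also minimizes
  -- over `C`.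
  have h0 := hpyth _ (hmem 0 n.zero_le) (onesVec d) (fun i => by simp [onesVec])
    (hinit.on_subset Set.inter_subset_left)
  have h1 := bregmanDiv_linpolyPotential_onesVec_le hq hη.le hv
  have h2 := bregmanDiv_linpolyPotential_nonneg hq hη.le hv0 (hpos _ (hmem n le_rfl))
  linarith

/-! ### Integration against the conditional law of the action -/

/-- Testing a conditional probability against a nonnegative function. -/
theorem setLIntegral_eq_lintegral_mul_of_condExp {Ω : Type*} {m mΩ : MeasurableSpace Ω}
    {P : Measure Ω} [IsProbabilityMeasure P] (hm : m ≤ mΩ) {A : Set Ω} (hA : MeasurableSet A)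
    {f : Ω → ℝ} (hf : Measurable f) (hAf : P[A.indicator (fun _ => (1 : ℝ)) | m] =ᵐ[P] f)
    {g : Ω → ENNReal} (hg : Measurable[m] g) :
    ∫⁻ ω in A, g ω ∂P = ∫⁻ ω, ENNReal.ofReal (f ω) * g ω ∂P := by
  have hint : Integrable (A.indicator fun _ => (1 : ℝ)) P :=
    (integrable_const 1).indicator hA
  have hf0 : 0 ≤ᵐ[P] f := by
    have h0 : 0 ≤ᵐ[P] P[A.indicator (fun _ => (1 : ℝ)) | m] :=
      condExp_nonneg (ae_of_all _ fun ω => Set.indicator_nonneg (fun _ _ => zero_le_one) ω)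
    filter_upwards [h0, hAf] with ω h1 h2
    rwa [← h2]
  have hfint : Integrable f P := integrable_condExp.congr hAf
  have hmeas : (P.restrict A).trim hm =
      (P.withDensity fun ω => ENNReal.ofReal (f ω)).trim hm := by
    -- The definition of conditional expectation says exactly that `P` restricted to `A` and `P`
    -- with density `f` agree on `m`; an `m`-measurable integrand sees nothing else.
    refine @Measure.ext _ m _ _ fun s hs => ?_
    rw [trim_measurableSet_eq hm hs, trim_measurableSet_eq hm hs,
      withDensity_apply _ (hm s hs), Measure.restrict_apply (hm s hs),
      ← ofReal_integral_eq_lintegral_ofReal hfint.integrableOn (ae_restrict_of_ae hf0),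
      ← setIntegral_congr_ae (hm s hs) (hAf.mono fun ω h _ => h),
      setIntegral_condExp hm hint hs, setIntegral_indicator hA]
    simp
  rw [← lintegral_trim hm hg, hmeas, lintegral_trim hm hg,
    lintegral_withDensity_eq_lintegral_mul _ hf.ennreal_ofReal (hg.mono hm le_rfl)]
  rfl

/-- Equality of lower integrals transfers finiteness as well as the value, so only `f * g` has to be
integrable; `g` alone need not be. -/
theorem integrable_indicator_and_integral_eq_of_condExp {Ω : Type*} {m mΩ : MeasurableSpace Ω}
    {P : Measure Ω} [IsProbabilityMeasure P] (hm : m ≤ mΩ) {A : Set Ω} (hA : MeasurableSet A)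
    {f : Ω → ℝ} (hf : Measurable f) (hf0 : ∀ ω, 0 ≤ f ω)
    (hAf : P[A.indicator (fun _ => (1 : ℝ)) | m] =ᵐ[P] f)
    {g : Ω → ℝ} (hg : Measurable[m] g) (hg0 : ∀ ω, 0 ≤ g ω)
    (hint : Integrable (fun ω => f ω * g ω) P) :
    Integrable (A.indicator g) P ∧ ∫ ω, A.indicator g ω ∂P = ∫ ω, f ω * g ω ∂P := by
  have hgm : Measurable g := hg.mono hm le_rfl
  have key : ∫⁻ ω, ENNReal.ofReal (A.indicator g ω) ∂P
      = ∫⁻ ω, ENNReal.ofReal (f ω * g ω) ∂P := by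
    have h := setLIntegral_eq_lintegral_mul_of_condExp hm hA hf hAf hg.ennreal_ofReal
    rw [← lintegral_indicator hA] at h
    simp only [ENNReal.ofReal_mul (hf0 _), ← h]
    refine lintegral_congr fun ω => ?_
    by_cases hω : ω ∈ A <;> simp [hω]
  have hi0 : ∀ ω, 0 ≤ A.indicator g ω := Set.indicator_nonneg fun ω _ => hg0 ω
  have him : AEStronglyMeasurable (A.indicator g) P :=
    (hgm.indicator hA).aestronglyMeasurable
  constructor
  · refine ⟨him, ?_⟩
    rw [hasFiniteIntegral_iff_ofReal (ae_of_all _ hi0), key]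
    exact (hasFiniteIntegral_iff_ofReal
      (ae_of_all _ fun ω => mul_nonneg (hf0 ω) (hg0 ω))).1 hint.2
  · rw [integral_eq_lintegral_of_nonneg_ae (ae_of_all _ hi0) him, key,
      ← integral_eq_lintegral_of_nonneg_ae
        (ae_of_all _ fun ω => mul_nonneg (hf0 ω) (hg0 ω)) hint.1]

section Game

variable {d : ℕ} {Ω : Type*} {mΩ : MeasurableSpace Ω} {P : Measure Ω} {ℱ : Filtration ℕ mΩ}
  {S : Finset (EuclideanSpace ℝ (Fin d))} {n : ℕ} {p : ℕ → Ω → EuclideanSpace ℝ (Fin d) → ℝ}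
  {V l : ℕ → Ω → EuclideanSpace ℝ (Fin d)}

theorem IsPredictionGame.sup_comap_le (hgame : IsPredictionGame P ℱ S n p V l) {t : ℕ}
    (ht : t < n) : ℱ t ⊔ MeasurableSpace.comap (l t) inferInstance ≤ mΩ :=
  sup_le (ℱ.le t) (((hgame.l_meas t ht).mono (ℱ.le _) le_rfl).comap_le)

/-- The conditional mean of the action: a quantity `h` known once the past and the present loss are
known may be integrated against `∑ v, p v • v` instead of `V`. -/
theorem IsPredictionGame.integral_mul_action [IsProbabilityMeasure P]
    (hgame : IsPredictionGame P ℱ S n p V l) {t : ℕ} (ht : t < n)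
    (hp : ∀ ω, ∀ v ∈ S, 0 ≤ p t ω v) (i : Fin d) (hS0 : ∀ v ∈ S, 0 ≤ v i) {h : Ω → ℝ}
    (hh : Measurable[ℱ t ⊔ MeasurableSpace.comap (l t) inferInstance] h)
    (hh0 : ∀ ω, 0 ≤ h ω)
    (hint : Integrable (fun ω => h ω * ∑ v ∈ S, p t ω v * v i) P) :
    Integrable (fun ω => h ω * V t ω i) P ∧
      ∫ ω, h ω * V t ω i ∂P = ∫ ω, h ω * ∑ v ∈ S, p t ω v * v i ∂P := by
  have hm := hgame.sup_comap_le ht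
  have hhm : Measurable h := hh.mono hm le_rfl
  have hpm : ∀ v ∈ S, Measurable fun ω => p t ω v := fun v hv =>
    (hgame.p_meas t ht v hv).mono (ℱ.le t) le_rfl
  have hVm : Measurable (V t) := (hgame.V_meas t ht).mono (ℱ.le _) le_rfl
  -- All summands are nonnegative, so each one is dominated by the whole sum.
  have hvint : ∀ v ∈ S, Integrable (fun ω => p t ω v * (h ω * v i)) P := by
    intro v hv
    refine hint.mono' ((hpm v hv).mul (hhm.mul_const _)).aestronglyMeasurable
      (ae_of_all _ fun ω => ?_)
    have h1 : ∀ u ∈ S, 0 ≤ p t ω u * u i := fun u hu => mul_nonneg (hp ω u hu) (hS0 u hu)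
    rw [Real.norm_of_nonneg (mul_nonneg (hp ω v hv) (mul_nonneg (hh0 ω) (hS0 v hv))),
      mul_left_comm]
    exact mul_le_mul_of_nonneg_left (Finset.single_le_sum h1 hv) (hh0 ω)
  have hv : ∀ v ∈ S, Integrable ((V t ⁻¹' {v}).indicator fun ω => h ω * v i) P ∧
      ∫ ω, (V t ⁻¹' {v}).indicator (fun ω => h ω * v i) ω ∂P =
        ∫ ω, p t ω v * (h ω * v i) ∂P := fun v hv =>
    integrable_indicator_and_integral_eq_of_condExp hm
      (hVm (measurableSet_singleton v)) (hpm v hv) (fun ω => hp ω v hv) (hgame.draw t ht v hv)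
      (hh.mul_const (v i)) (fun ω => mul_nonneg (hh0 ω) (hS0 v hv)) (hvint v hv)
  -- Split according to which of the finitely many actions is drawn.
  have hdecomp : (fun ω => h ω * V t ω i) =
      fun ω => ∑ v ∈ S, (V t ⁻¹' {v}).indicator (fun ω => h ω * v i) ω := by
    ext ω
    rw [Finset.sum_eq_single_of_mem _ (hgame.V_mem t ht ω)]
    · simp
    · intro v _ hne
      have hn : ω ∉ V t ⁻¹' {v} := fun hmem => hne (Eq.symm hmem)
      rw [Set.indicator_of_notMem hn]
  rw [hdecomp]
  refine ⟨integrable_finsetSum _ fun v hvS => (hv v hvS).1, ?_⟩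
  rw [integral_finsetSum _ fun v hvS => (hv v hvS).1,
    Finset.sum_congr rfl fun v hvS => (hv v hvS).2, ← integral_finsetSum _ hvint]
  refine integral_congr_ae (ae_of_all _ fun ω => ?_)
  simp only [Finset.mul_sum]
  exact Finset.sum_congr rfl fun v _ => by ring

end Game

/-! ### From the pathwise bound to the expected regret -/

theorem integrable_of_measurable_of_nonneg_of_le {Ω : Type*} {mΩ : MeasurableSpace Ω}
    {P : Measure Ω} [IsFiniteMeasure P] {f : Ω → ℝ} {c : ℝ} (hf : Measurable f)
    (h0 : ∀ ω, 0 ≤ f ω) (h1 : ∀ ω, f ω ≤ c) : Integrable f P :=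
  Integrable.of_bound hf.aestronglyMeasurable c
    (ae_of_all _ fun ω => by rw [Real.norm_of_nonneg (h0 ω)]; exact h1 ω)

theorem integral_const_add_add_const_mul {Ω : Type*} {mΩ : MeasurableSpace Ω}
    {P : Measure Ω} [IsProbabilityMeasure P] {f g : Ω → ℝ} (hf : Integrable f P)
    (hg : Integrable g P) (a b : ℝ) :
    ∫ ω, (a + (f ω + b * g ω)) ∂P = a + (∫ ω, f ω ∂P + b * ∫ ω, g ω ∂P) := by
  have hfg : Integrable (fun ω => f ω + b * g ω) P := hf.add (hg.const_mul b)
  rw [integral_add (integrable_const _) hfg, integral_add hf (hg.const_mul b),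
    integral_const_mul]
  simp

/-- The pathwise regret bound of linpoly, with the estimates written out. -/
theorem IsLinpolyRun.sum_inner_le {d : ℕ} {q η : ℝ} {S : Finset (EuclideanSpace ℝ (Fin d))}
    {n : ℕ} {w : ℕ → EuclideanSpace ℝ (Fin d)} {p : ℕ → EuclideanSpace ℝ (Fin d) → ℝ}
    {V l : ℕ → EuclideanSpace ℝ (Fin d)} (hq : 1 < q) (hη : 0 < η)
    (hS01 : ∀ v ∈ S, ∀ i, v i = 0 ∨ v i = 1) (hrun : IsLinpolyRun q η S n w p V l)
    (hw : ∀ t < n, ∀ i, 0 < w t i)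
    (hV : ∀ t < n, V t ∈ S) (hl : ∀ t < n, ∀ i, 0 ≤ l t i)
    {v : EuclideanSpace ℝ (Fin d)} (hv : v ∈ S) :
    ∑ t ∈ Finset.range n, inner ℝ (l t) (V t) ≤
      d / ((q - 1) * η) +
        (∑ t ∈ Finset.range n, ∑ i, l t i / w t i * V t i * v i +
          η * q / 2 * ∑ t ∈ Finset.range n, ∑ i, l t i ^ 2 * (w t i) ^ (1 / q - 1) * V t i) := by
  have h01 : ∀ t < n, ∀ i, V t i = 0 ∨ V t i = 1 := fun t ht => hS01 _ (hV t ht)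
  have h := hrun.cleb.sum_inner_sub_le hq hη hrun.init_min (fun t ht i => by
    have hVi : 0 ≤ V t i := by rcases h01 t ht i with h | h <;> simp [h]
    exact mul_nonneg (hl t ht i) (div_nonneg hVi (hw t ht i).le)) hv (hS01 v hv)
  -- The weights cancel against `w t`: the estimated loss of `w t` is exactly the loss incurred by
  -- `V t`, without taking expectations.
  have e1 : ∀ t ∈ Finset.range n,
      inner ℝ (importanceWeightedEst (l t) (V t) (w t)) (w t - v) =
        inner ℝ (l t) (V t) - ∑ i, l t i / w t i * V t i * v i := by
    intro t ht
    have ht' := Finset.mem_range.1 ht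
    simp only [importanceWeightedEst, PiLp.inner_apply, ← Finset.sum_sub_distrib,
      RCLike.inner_apply, conj_trivial, PiLp.sub_apply]
    refine Finset.sum_congr rfl fun i _ => ?_
    have := (hw t ht' i).ne'
    field_simp
  have e2 : ∀ t ∈ Finset.range n,
      ∑ i, (w t i) ^ (1 + 1 / q) * (importanceWeightedEst (l t) (V t) (w t)) i ^ 2 =
        ∑ i, l t i ^ 2 * (w t i) ^ (1 / q - 1) * V t i := by
    intro t ht
    have ht' := Finset.mem_range.1 ht
    refine Finset.sum_congr rfl fun i _ => ?_
    have hwi := hw t ht' i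
    have hVV : V t i ^ 2 = V t i := by rcases h01 t ht' i with h | h <;> simp [h]
    rw [show 1 + 1 / q = (1 / q - 1) + (2 : ℕ) by push_cast; ring, Real.rpow_add hwi,
      Real.rpow_natCast]
    simp only [importanceWeightedEst]
    rw [mul_pow, div_pow, hVV]
    field_simp
  rw [Finset.sum_congr rfl e1, Finset.sum_congr rfl e2, Finset.sum_sub_distrib] at h
  linarith

theorem expectedRegret_linpoly_le {d : ℕ} {n : ℕ}
    (S : Finset (EuclideanSpace ℝ (Fin d))) (hS : S.Nonempty)
    (hS01 : ∀ v ∈ S, ∀ i, v i = 0 ∨ v i = 1)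
    (hScover : ∀ i, ∃ v ∈ S, v i = 1)
    {q η : ℝ} (hq : 1 < q) (hη : 0 < η)
    {Ω : Type*} {mΩ : MeasurableSpace Ω} (P : Measure Ω) [IsProbabilityMeasure P]
    (ℱ : Filtration ℕ mΩ)
    (w : ℕ → Ω → EuclideanSpace ℝ (Fin d))
    (p : ℕ → Ω → EuclideanSpace ℝ (Fin d) → ℝ)
    (V l : ℕ → Ω → EuclideanSpace ℝ (Fin d))
    (hgame : IsPredictionGame P ℱ S n p V l)
    (hL2 : ∀ t < n, ∀ ω, ∀ v ∈ S, inner ℝ (l t ω) v ≤ 1)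
    (hrun : ∀ ω, IsLinpolyRun q η S n (fun t => w t ω) (fun t => p t ω)
      (fun t => V t ω) (fun t => l t ω)) :
    expectedRegret P S hS n V l ≤
      d / ((q - 1) * η) + η * q / 2 * (n * (d : ℝ) ^ (1 - 1 / q)) := by
  have hS0 : ∀ v ∈ S, ∀ i, 0 ≤ v i := fun v hv i => by
    rcases hS01 v hv i with h | h <;> simp [h]
  have hw : ∀ ω, ∀ t < n, ∀ i, 0 < w t ω i := by
    intro ω t ht
    have hmem : w t ω ∈ interior (nonnegOrthant d) := by
      rcases t with _ | t
      · exact (hrun ω).cleb.init_mem.2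
      · obtain ⟨_, _, _, h, _⟩ := (hrun ω).cleb.update t (by omega)
        exact h.2
    rwa [interior_nonnegOrthant] at hmem
  have hmean : ∀ t < n, ∀ ω i, ∑ v ∈ S, p t ω v * v i = w t ω i := by
    intro t ht ω i
    have h := congrArg (fun x : EuclideanSpace ℝ (Fin d) => x i) ((hrun ω).cleb.p_mean t ht)
    simpa using h
  have hp : ∀ t < n, ∀ ω, ∀ v ∈ S, 0 ≤ p t ω v := fun t ht ω => (hrun ω).cleb.p_nonneg t ht
  have hl0 := hgame.l_nonneg
  have hl1 : ∀ t < n, ∀ ω i, l t ω i ≤ 1 := by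
    intro t ht ω i
    obtain ⟨v, hv, hvi⟩ := hScover i
    refine le_trans ?_ (hL2 t ht ω v hv)
    simp only [PiLp.inner_apply, RCLike.inner_apply, conj_trivial]
    have := Finset.single_le_sum (f := fun j => v j * l t ω j)
      (fun j _ => mul_nonneg (hS0 v hv j) (hl0 t ht ω j)) (Finset.mem_univ i)
    simpa [hvi] using this
  -- `w t` is a mixture of actions, each of loss at most 1.
  have hlw : ∀ t < n, ∀ ω, ∑ i, l t ω i * w t ω i ≤ 1 := by
    intro t ht ω
    have h1 : ∑ i, l t ω i * w t ω i = ∑ v ∈ S, p t ω v * inner ℝ (l t ω) v := by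
      simp only [← hmean t ht ω, PiLp.inner_apply, RCLike.inner_apply, conj_trivial,
        Finset.mul_sum]
      rw [Finset.sum_comm]
      exact Finset.sum_congr rfl fun v _ => Finset.sum_congr rfl fun i _ => by ring
    rw [h1, ← (hrun ω).cleb.p_sum t ht]
    exact Finset.sum_le_sum fun v hv =>
      mul_le_of_le_one_right (hp t ht ω v hv) (hL2 t ht ω v hv)
  have hvar : ∀ t < n, ∀ ω, ∑ i, l t ω i ^ 2 * (w t ω i) ^ (1 / q) ≤ (d : ℝ) ^ (1 - 1 / q) := by
    intro t ht ω
    have := sum_sq_mul_rpow_le Finset.univ hq (fun i => l t ω i) (fun i => w t ω i)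
      (fun i _ => hl0 t ht ω i) (fun i _ => hl1 t ht ω i) (fun i _ => (hw ω t ht i).le)
      (hlw t ht ω)
    simpa using this
  have hcoord : ∀ i, Measurable fun x : EuclideanSpace ℝ (Fin d) => x i := fun i => by fun_prop
  have hlG : ∀ t i, Measurable[ℱ t ⊔ MeasurableSpace.comap (l t) inferInstance]
      fun ω => l t ω i := fun t i =>
    ((hcoord i).comp (comap_measurable (l t))).mono le_sup_right le_rfl
  -- Measurability of the weights comes from that of `p t`, whose mean they are.
  have hwG : ∀ t < n, ∀ i, Measurable[ℱ t ⊔ MeasurableSpace.comap (l t) inferInstance]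
      fun ω => w t ω i := by
    intro t ht i
    simp only [← hmean t ht]
    exact (Finset.measurable_fun_sum S fun v hv =>
      (hgame.p_meas t ht v hv).mul_const (v i)).mono le_sup_left le_rfl
  have hlm : ∀ t < n, ∀ i, Measurable fun ω => l t ω i := fun t ht i =>
    (hlG t i).mono (hgame.sup_comap_le ht) le_rfl
  have hwm : ∀ t < n, ∀ i, Measurable fun ω => w t ω i := fun t ht i =>
    (hwG t ht i).mono (hgame.sup_comap_le ht) le_rfl
  have hlint : ∀ t < n, ∀ i, Integrable (fun ω => l t ω i) P := fun t ht i =>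
    integrable_of_measurable_of_nonneg_of_le (hlm t ht i) (fun ω => hl0 t ht ω i)
      fun ω => hl1 t ht ω i
  have hinner : ∀ t < n, ∀ v ∈ S, ∀ ω, inner ℝ (l t ω) v = ∑ i, l t ω i * v i := by
    intro t _ v _ ω
    simp [PiLp.inner_apply, mul_comm]
  -- Unbiasedness: replacing `V` by its conditional mean `w` cancels the denominator, leaving a
  -- bounded integrand.
  have hest : ∀ t < n, ∀ i, Integrable (fun ω => l t ω i / w t ω i * V t ω i) P ∧
      ∫ ω, l t ω i / w t ω i * V t ω i ∂P = ∫ ω, l t ω i ∂P := by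
    intro t ht i
    have e : (fun ω => l t ω i / w t ω i * ∑ v ∈ S, p t ω v * v i) = fun ω => l t ω i := by
      ext ω
      rw [hmean t ht, div_mul_cancel₀ _ (hw ω t ht i).ne']
    have := hgame.integral_mul_action ht (hp t ht) i (fun v hv => hS0 v hv i)
      ((hlG t i).div (hwG t ht i))
      (fun ω => div_nonneg (hl0 t ht ω i) (hw ω t ht i).le) (by
        simp only [Pi.div_apply]
        rw [e]
        exact hlint t ht i)
    simp only [Pi.div_apply] at this
    rwa [e] at this
  have hvint : ∀ t < n, ∀ i, Integrable (fun ω => l t ω i ^ 2 * (w t ω i) ^ (1 / q)) P := by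
    intro t ht i
    have hnn : ∀ ω j, 0 ≤ l t ω j ^ 2 * (w t ω j) ^ (1 / q) := fun ω j =>
      mul_nonneg (sq_nonneg _) (Real.rpow_nonneg (hw ω t ht j).le _)
    refine integrable_of_measurable_of_nonneg_of_le (c := (d : ℝ) ^ (1 - 1 / q))
      (((hlm t ht i).pow_const 2).mul ((hwm t ht i).pow_const (1 / q))) (fun ω => hnn ω i)
      fun ω => ?_
    exact (Finset.single_le_sum (fun j _ => hnn ω j) (Finset.mem_univ i)).trans (hvar t ht ω)
  have hsq : ∀ t < n, ∀ i,
      Integrable (fun ω => l t ω i ^ 2 * (w t ω i) ^ (1 / q - 1) * V t ω i) P ∧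
      ∫ ω, l t ω i ^ 2 * (w t ω i) ^ (1 / q - 1) * V t ω i ∂P =
        ∫ ω, l t ω i ^ 2 * (w t ω i) ^ (1 / q) ∂P := by
    intro t ht i
    have e : (fun ω => l t ω i ^ 2 * (w t ω i) ^ (1 / q - 1) * ∑ v ∈ S, p t ω v * v i) =
        fun ω => l t ω i ^ 2 * (w t ω i) ^ (1 / q) := by
      ext ω
      rw [hmean t ht, mul_assoc, ← Real.rpow_add_one (hw ω t ht i).ne', sub_add_cancel]
    have := hgame.integral_mul_action ht (hp t ht) i (fun v hv => hS0 v hv i)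
      (h := fun ω => l t ω i ^ 2 * (w t ω i) ^ (1 / q - 1))
      (((hlG t i).pow_const 2).mul ((hwG t ht i).pow_const (1 / q - 1)))
      (fun ω => mul_nonneg (sq_nonneg _) (Real.rpow_nonneg (hw ω t ht i).le _)) (by
        rw [e]
        exact hvint t ht i)
    rwa [e] at this
  -- The best action in expectation is deterministic, so the pathwise bound can be applied with the
  -- same `v` for every `ω`.
  obtain ⟨v, hv, hvmin⟩ := S.exists_mem_eq_inf' hS
    (fun v => ∫ ω, ∑ t ∈ Finset.range n, inner ℝ (l t ω) v ∂P)
  rw [expectedRegret, hvmin, sub_le_iff_le_add]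
  have hV := hgame.V_mem
  have hpath : ∀ ω, ∑ t ∈ Finset.range n, inner ℝ (l t ω) (V t ω) ≤
      d / ((q - 1) * η) +
        (∑ t ∈ Finset.range n, ∑ i, l t ω i / w t ω i * V t ω i * v i +
          η * q / 2 * ∑ t ∈ Finset.range n, ∑ i,
            l t ω i ^ 2 * (w t ω i) ^ (1 / q - 1) * V t ω i) := fun ω =>
    (hrun ω).sum_inner_le hq hη hS01 (hw ω) (fun t ht => hV t ht ω) (fun t ht => hl0 t ht ω) hv
  have hi1 : Integrable (fun ω => ∑ t ∈ Finset.range n, ∑ i,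
      l t ω i / w t ω i * V t ω i * v i) P :=
    integrable_finsetSum _ fun t ht => integrable_finsetSum _ fun i _ =>
      (hest t (Finset.mem_range.1 ht) i).1.mul_const _
  have hi2 : Integrable (fun ω => ∑ t ∈ Finset.range n, ∑ i,
      l t ω i ^ 2 * (w t ω i) ^ (1 / q - 1) * V t ω i) P :=
    integrable_finsetSum _ fun t ht => integrable_finsetSum _ fun i _ =>
      (hsq t (Finset.mem_range.1 ht) i).1
  have hi0 : Integrable (fun ω => ∑ t ∈ Finset.range n, inner ℝ (l t ω) (V t ω)) P := by
    refine integrable_finsetSum _ fun t ht => ?_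
    have ht' := Finset.mem_range.1 ht
    refine integrable_of_measurable_of_nonneg_of_le (c := 1) ?_ (fun ω => ?_)
      fun ω => hL2 t ht' ω _ (hV t ht' ω)
    · exact Measurable.inner ((hgame.l_meas t ht').mono (ℱ.le _) le_rfl)
        ((hgame.V_meas t ht').mono (ℱ.le _) le_rfl)
    · rw [hinner t ht' _ (hV t ht' ω)]
      exact Finset.sum_nonneg fun i _ =>
        mul_nonneg (hl0 t ht' ω i) (hS0 _ (hV t ht' ω) i)
  have hint := integral_mono hi0
    ((integrable_const _).add (hi1.add (hi2.const_mul (η * q / 2)))) hpath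
  have hmain : ∫ ω, ∑ t ∈ Finset.range n, ∑ i, l t ω i / w t ω i * V t ω i * v i ∂P =
      ∫ ω, ∑ t ∈ Finset.range n, inner ℝ (l t ω) v ∂P := by
    have hi : ∀ t ∈ Finset.range n, Integrable (fun ω => inner ℝ (l t ω) v) P := by
      intro t ht
      have ht' := Finset.mem_range.1 ht
      simp only [hinner t ht' v hv]
      exact integrable_finsetSum _ fun i _ => (hlint t ht' i).mul_const _
    rw [integral_finsetSum _ fun t ht => integrable_finsetSum _ fun i _ =>
      (hest t (Finset.mem_range.1 ht) i).1.mul_const _, integral_finsetSum _ hi]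
    refine Finset.sum_congr rfl fun t ht => ?_
    have ht' := Finset.mem_range.1 ht
    simp only [hinner t ht' v hv]
    rw [integral_finsetSum _ fun i _ => (hest t ht' i).1.mul_const _,
      integral_finsetSum _ fun i _ => (hlint t ht' i).mul_const _]
    refine Finset.sum_congr rfl fun i _ => ?_
    rw [integral_mul_const, integral_mul_const, (hest t ht' i).2]
  have hsecond : ∫ ω, ∑ t ∈ Finset.range n, ∑ i,
      l t ω i ^ 2 * (w t ω i) ^ (1 / q - 1) * V t ω i ∂P ≤ n * (d : ℝ) ^ (1 - 1 / q) := by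
    rw [integral_finsetSum _ fun t ht => integrable_finsetSum _ fun i _ =>
      (hsq t (Finset.mem_range.1 ht) i).1]
    calc _ ≤ ∑ _t ∈ Finset.range n, (d : ℝ) ^ (1 - 1 / q) := by
          refine Finset.sum_le_sum fun t ht => ?_
          have ht' := Finset.mem_range.1 ht
          rw [integral_finsetSum _ fun i _ => (hsq t ht' i).1,
            Finset.sum_congr rfl fun i _ => (hsq t ht' i).2,
            ← integral_finsetSum _ fun i _ => hvint t ht' i]
          calc _ ≤ ∫ _ω, (d : ℝ) ^ (1 - 1 / q) ∂P :=
                integral_mono (integrable_finsetSum _ fun i _ => hvint t ht' i)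
                  (integrable_const _) (hvar t ht')
            _ = _ := by simp
      _ = _ := by simp
  have hq0 : 0 < q := by linarith
  have h2 := mul_le_mul_of_nonneg_left hsecond (show 0 ≤ η * q / 2 by positivity)
  have h3 := hint.trans_eq (integral_const_add_add_const_mul hi1 hi2 _ _)
  rw [hmain] at h3
  linarith

/-! ### Choice of the parameters -/

theorem linpoly_tuned_bound {q η D N : ℝ} (hq : 1 < q) (hD : 0 < D) (hN : 0 < N)
    (hη : η = √(2 * D ^ (1 / q) / (q * (q - 1) * N))) :
    D / ((q - 1) * η) + η * q / 2 * (N * D ^ (1 - 1 / q)) =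
      √(2 * q * N * D / (q - 1) * D ^ (1 - 1 / q)) := by
  have hq1 : 0 < q - 1 := by linarith
  have hq0 : 0 < q := by linarith
  have hη0 : 0 < η := by rw [hη]; positivity
  have hη2 : η ^ 2 * (q * (q - 1) * N) = 2 * D ^ (1 / q) := by
    rw [hη, Real.sq_sqrt (by positivity)]
    field_simp
  set A := D ^ (1 / q) with hA
  have hA0 : 0 < A := by positivity
  have hK : D ^ (1 - 1 / q) = D / A := by rw [hA, Real.rpow_sub hD, Real.rpow_one]
  rw [hK]
  -- The prescribed `η` makes both terms equal, so the bound is twice the first one.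
  have hfirst : η * q / 2 * (N * (D / A)) = D / ((q - 1) * η) := by
    field_simp
    linarith
  rw [hfirst]
  symm
  rw [Real.sqrt_eq_iff_mul_self_eq_of_pos (by positivity)]
  have : N = 2 * A / (η ^ 2 * (q * (q - 1))) := by
    field_simp
    linarith
  rw [this]
  field_simp
  ring

/-- For this `q`, `q / (q - 1) = 1 + log D` and `1 - 1 / q = 1 / (1 + log D)`, so the power of `D`
has logarithm `log D / (1 + log D) ≤ 1`. -/
theorem rpow_one_sub_inv_le_exp_one {D q : ℝ} (hD : 1 < D) (hq : q = 1 + (Real.log D)⁻¹) :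
    q / (q - 1) = Real.log (Real.exp 1 * D) ∧ D ^ (1 - 1 / q) ≤ Real.exp 1 := by
  have hL : 0 < Real.log D := Real.log_pos hD
  have hD0 : 0 < D := by linarith
  constructor
  · rw [Real.log_mul (Real.exp_pos 1).ne' hD0.ne', Real.log_exp, hq]
    field_simp
    ring
  · rw [Real.rpow_def_of_pos hD0, Real.exp_le_exp, hq]
    have : Real.log D * (1 - 1 / (1 + (Real.log D)⁻¹)) = Real.log D / (Real.log D + 1) := by
      field_simp
      ring
    rw [this, div_le_one (by positivity)]
    linarith

theorem mainTheorem4 {d : ℕ} (hd : 0 < d) {n : ℕ} (hn : 0 < n)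
    (S : Finset (EuclideanSpace ℝ (Fin d))) (hS : S.Nonempty)
    (hS01 : ∀ v ∈ S, ∀ i, v i = 0 ∨ v i = 1)
    (hScover : ∀ i, ∃ v ∈ S, v i = 1)
    (q η : ℝ) (hq : 1 < q)
    (hη : η = √(2 * (d : ℝ) ^ (1 / q) / (q * (q - 1) * n)))
    {Ω : Type*} {mΩ : MeasurableSpace Ω} (P : Measure Ω) [IsProbabilityMeasure P]
    (ℱ : Filtration ℕ mΩ)
    (w : ℕ → Ω → EuclideanSpace ℝ (Fin d))
    (p : ℕ → Ω → EuclideanSpace ℝ (Fin d) → ℝ)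
    (V l : ℕ → Ω → EuclideanSpace ℝ (Fin d))
    (hgame : IsPredictionGame P ℱ S n p V l)
    (hL2 : ∀ t < n, ∀ ω, ∀ v ∈ S, inner ℝ (l t ω) v ≤ 1)
    (hrun : ∀ ω, IsLinpolyRun q η S n (fun t => w t ω) (fun t => p t ω)
      (fun t => V t ω) (fun t => l t ω)) :
    expectedRegret P S hS n V l ≤
        √(2 * q * n * d / (q - 1) * (d : ℝ) ^ (1 - 1 / q)) ∧
      (2 ≤ d → q = 1 + (Real.log d)⁻¹ →
        expectedRegret P S hS n V l ≤
          √(2 * n * d * Real.exp 1 * Real.log (Real.exp 1 * d))) := by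
  have hD : (0 : ℝ) < d := by exact_mod_cast hd
  have hN : (0 : ℝ) < n := by exact_mod_cast hn
  have hq1 : 0 < q - 1 := by linarith
  have hq0 : 0 < q := by linarith
  have hη0 : 0 < η := by rw [hη]; positivity
  have h := (expectedRegret_linpoly_le S hS hS01 hScover hq hη0 P ℱ w p V l hgame hL2 hrun).trans_eq
    (linpoly_tuned_bound hq hD hN hη)
  refine ⟨h, fun hd2 hqd => h.trans (Real.sqrt_le_sqrt ?_)⟩
  have hd1 : (1 : ℝ) < d := by exact_mod_cast hd2
  obtain ⟨h1, h2⟩ := rpow_one_sub_inv_le_exp_one hd1 hqd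
  rw [show 2 * q * n * d / (q - 1) = 2 * n * d * (q / (q - 1)) by ring, h1,
    mul_right_comm _ (Real.exp 1)]
  have : 0 ≤ Real.log (Real.exp 1 * d) := h1 ▸ (by positivity)
  gcongr
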